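/- Let $\mathbb{N}^\times$ be the multiplicative monoid of positive integers, regarded as a category with a single object, and let $\widehat{\mathbb{N}^\times}$ be the topos of contravariant functors from this category to the category of sets. A point of $\widehat{\mathbb{N}^\times}$ is a geometric morphism $f$ from the topos of sets to $\widehat{\mathbb{N}^\times}$, i.e. an adjoint pair $f^*\dashv f_*$ with $f_*:\mathbf{Sets}\to\widehat{\mathbb{N}^\times}$ and $f^*:\widehat{\mathbb{N}^\times}\to\mathbf{Sets}$ such that $f^*$ preserves finite limits; a morphism of points $f\to g$ is a natural transformation $f^*\to g^*$. Let $\mathbb{Z}_{\max}=(\mathbb{Z}\cup\{-\infty\},\max,+)$ and $\mathbb{Q}_{\max}=(\mathbb{Q}\cup\{-\infty\},\max,+)$ be the max-plus semifields (addition is $\max$, multiplication is $+$), with $\mathbb{Z}_{\max}\subset\mathbb{Q}_{\max}$ induced by $\mathbb{Z}\subset\mathbb{Q}$. Then the category of points of $\widehat{\mathbb{N}^\times}$ is equivalent to the category of algebraic extensions of $\mathbb{Z}_{\max}$, that is, the category whose objects are the intermediate semifields $\mathbb{Z}_{\max}\subset K\subset\mathbb{Q}_{\max}$ and whose morphisms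 $K\to L$ are all injective morphisms of semifields (not required to restrict to the identity on $\mathbb{Z}_{\max}$). -/

import Mathlib

open CategoryTheory

/-- A geometric morphism `f : E ⟶ F`: a pair of adjoint functors `f^* ⊣ f_*`, with
`f_* : E ⥤ F` and `f^* : F ⥤ E`, such that `f^*` preserves finite limits. -/
structure GeometricMorphism (E : Type*) [Category E] (F : Type*) [Category F] where
  /-- the direct image functor `f_*` -/
  directImage : E ⥤ F
  /-- the inverse image functor `f^*` -/
  inverseImage : F ⥤ E
  /-- the adjunction `f^* ⊣ f_*` -/
  adj : inverseImage ⊣ directImage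
  /-- the inverse image functor is left exact -/
  preservesFiniteLimits : Limits.PreservesFiniteLimits inverseImage

/-- Morphisms `f ⟶ g` of geometric morphisms are natural transformations `f^* ⟶ g^*`
of the inverse image functors. -/
instance GeometricMorphism.category (E : Type*) [Category E] (F : Type*) [Category F] :
    Category (GeometricMorphism E F) where
  Hom f g := f.inverseImage ⟶ g.inverseImage
  id f := 𝟙 f.inverseImage
  comp a b := NatTrans.vcomp a b

/-- The category of points of a topos `T`: geometric morphisms from the topos of sets to `T`. -/
abbrev ToposPoint (T : Type*) [Category T] := GeometricMorphism (Type) T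

/-- The topos of contravariant functors to sets on the category with a single object whose
endomorphism monoid is the multiplicative monoid of positive integers. -/
abbrev NTimesTopos := (SingleObj ℕ+)ᵒᵖ ⥤ Type

/-- The max-plus semiring `(G ∪ {-∞}, max, +)` of a totally ordered abelian group `G`.
`Tropical` uses `min` and adjoins `+∞`, so the order of `G` is reversed. -/
abbrev MaxPlus (G : Type*) := Tropical (WithTop Gᵒᵈ)

namespace MaxPlus

variable {G : Type*} [AddCommGroup G] [LinearOrder G] [IsOrderedAddMonoid G]

/-- The max-plus semiring of a totally ordered abelian group is a semifield: the inverse of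
`g : G` is `-g`, and `(-∞)⁻¹ = -∞` by convention. -/
instance instSemifield : Semifield (MaxPlus G) where
  inv x := x⁻¹
  div_eq_mul_inv x y := congrArg Tropical.trop
    (sub_eq_add_neg (Tropical.untrop x) (Tropical.untrop y))
  inv_zero := congrArg Tropical.trop LinearOrderedAddCommGroupWithTop.neg_top
  mul_inv_cancel x hx := congrArg Tropical.trop
    (LinearOrderedAddCommGroupWithTop.add_neg_cancel_of_ne_top (x := Tropical.untrop x)
      (fun h => hx (congrArg Tropical.trop h)))
  nnqsmul := _
  nnqsmul_def := fun _ _ => rfl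

end MaxPlus

/-- The semifield `ℤ_max = (ℤ ∪ {-∞}, max, +)`. -/
abbrev ZMax := MaxPlus ℤ

/-- The semifield `ℚ_max = (ℚ ∪ {-∞}, max, +)`. -/
abbrev QMax := MaxPlus ℚ

/-- The inclusion `ℤ_max ⊂ ℚ_max` induced by `ℤ ⊂ ℚ`. -/
def zmaxToQMax : ZMax →+* QMax where
  toFun x := Tropical.trop ((Tropical.untrop x).map
    (fun n => OrderDual.toDual ((OrderDual.ofDual n : ℤ) : ℚ)))
  map_zero' := rfl
  map_one' :=
    congrArg (fun q : ℚ => Tropical.trop ((OrderDual.toDual q : ℚᵒᵈ) : WithTop ℚᵒᵈ))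
      Int.cast_zero
  map_mul' x y := by
    induction x using Tropical.tropRec with | _ x
    induction y using Tropical.tropRec with | _ y
    induction x using WithTop.recTopCoe with
    | top => rfl
    | coe a =>
      induction y using WithTop.recTopCoe with
      | top => rfl
      | coe b =>
        exact congrArg (fun q : ℚ => Tropical.trop ((OrderDual.toDual q : ℚᵒᵈ) : WithTop ℚᵒᵈ))
          (Int.cast_add (OrderDual.ofDual a) (OrderDual.ofDual b))
  map_add' x y := by
    have hm : Monotone (WithTop.map
        (fun n : ℤᵒᵈ => OrderDual.toDual ((OrderDual.ofDual n : ℤ) : ℚ))) :=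
      Monotone.withTop_map fun a b h =>
        OrderDual.toDual_le_toDual.2 (Int.cast_le.2 (OrderDual.ofDual_le_ofDual.2 h))
    exact congrArg Tropical.trop (hm.map_min (a := Tropical.untrop x) (b := Tropical.untrop y))

/-- An intermediate semifield `ℤ_max ⊂ K ⊂ ℚ_max`: a subsemiring of `ℚ_max` closed under
inverses and containing `ℤ_max`. -/
structure IntermediateSemifield extends Subsemiring QMax where
  /-- `K` is closed under inverses -/
  inv_mem' : ∀ x ∈ carrier, x⁻¹ ∈ carrier
  /-- `K` contains `ℤ_max` -/
  zmax_mem' : ∀ x : ZMax, zmaxToQMax x ∈ carrier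

namespace IntermediateSemifield

/-- The underlying semifield of an intermediate semifield, with the operations of `ℚ_max`. -/
abbrev Carrier (K : IntermediateSemifield) : Type := K.toSubsemiring

instance (K : IntermediateSemifield) : Semifield K.Carrier where
  inv x := ⟨(x : QMax)⁻¹, K.inv_mem' x x.2⟩
  inv_zero := Subtype.ext (inv_zero (G₀ := QMax))
  mul_inv_cancel x hx := Subtype.ext
    (mul_inv_cancel₀ (G₀ := QMax) (fun h => hx (Subtype.ext h)))
  nnqsmul := _
  nnqsmul_def := fun _ _ => rfl

/-- Morphisms are the injective morphisms of semifields `K → L`, which are not required to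
restrict to the identity on `ℤ_max`. -/
instance category : Category IntermediateSemifield where
  Hom K L := {f : K.Carrier →+* L.Carrier // Function.Injective f}
  id K := ⟨RingHom.id K.Carrier, Function.injective_id⟩
  comp f g := ⟨g.1.comp f.1, g.2.comp f.2⟩

end IntermediateSemifield

/-! The inverse image of a point of presheaves on `C` preserves colimits, so it is the left Kan
extension of its restriction `F` to representables. Left exactness makes the category of elements of
`F` cofiltered, and every such `F` arises from a point (`equivCofilteredElements`).

For `ℕ+`, such an `F` is a nonempty set with a free action in which any two elements are multiples
of a common one. Relative to a base point, each element is a positive rational multiple, so the set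
is the positive part of a subgroup of `ℚ` containing `ℤ` (`IsFlatAction.exists_equiv_pos`). These
subgroups are exactly the nonzero parts of the intermediate semifields. Injective semifield
morphisms preserve positivity, hence induce equivariant maps of positive parts; an equivariant map
is multiplication by a positive rational (`Pos.exists_eq_mul`), which extends uniquely to the
semifield. Thus `posFunctor` is an equivalence onto the functors with cofiltered elements. -/

open Limits Opposite

/-! ### Left exact cocontinuous functors on presheaves -/

section PresheafTopos

universe v

variable {C : Type v} [SmallCategory C]

/-- Every element of the value of a colimit-preserving functor at a presheaf comes from a
representable presheaf. -/
lemma exists_map_uliftYoneda_eq (L : (Cᵒᵖ ⥤ Type v) ⥤ Type v)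
    [PreservesColimitsOfSize.{v, v} L] (P : Cᵒᵖ ⥤ Type v) (p : L.obj P) :
    ∃ (X : C) (s : uliftYoneda.{v}.obj X ⟶ P) (x : L.obj (uliftYoneda.{v}.obj X)),
      L.map s x = p := by
  obtain ⟨j, x, hx⟩ := Types.jointly_surjective_of_isColimit
    (isColimitOfPreserves L (Presheaf.colimitOfRepresentable.{v} P)) p
  exact ⟨j.unop.1.unop, uliftYonedaEquiv.symm j.unop.2, x, hx⟩

/-- The restriction to representables of a functor preserving colimits and finite limits has a
cofiltered category of elements. -/
lemma isCofiltered_elements_uliftYoneda_comp (L : (Cᵒᵖ ⥤ Type v) ⥤ Type v)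
    [PreservesColimitsOfSize.{v, v} L] [PreservesFiniteLimits L] :
    IsCofiltered (uliftYoneda.{v} ⋙ L).Elements where
  cone_objs := by
    rintro ⟨X, x⟩ ⟨Y, y⟩
    -- `L` preserves the product, so `(x, y)` is an element of its value there; this element comes
    -- from a representable, and full faithfulness of Yoneda turns the two components into arrows of
    -- `C`.
    let hl := mapIsLimitOfPreservesOfIsLimit L _ _
      (prodIsProd (uliftYoneda.{v}.obj X) (uliftYoneda.{v}.obj Y))
    let c : BinaryFan (L.obj (uliftYoneda.{v}.obj X)) (L.obj (uliftYoneda.{v}.obj Y)) :=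
      BinaryFan.mk (P := PUnit) (↾fun _ ↦ x) (↾fun _ ↦ y)
    obtain ⟨Z, s, z, hz⟩ := exists_map_uliftYoneda_eq L _ (hl.lift c PUnit.unit)
    have h1 := ConcreteCategory.congr_hom (hl.fac c ⟨.left⟩) PUnit.unit
    have h2 := ConcreteCategory.congr_hom (hl.fac c ⟨.right⟩) PUnit.unit
    obtain ⟨t₁, ht₁⟩ := uliftYoneda.{v}.map_surjective (s ≫ prod.fst)
    obtain ⟨t₂, ht₂⟩ := uliftYoneda.{v}.map_surjective (s ≫ prod.snd)
    refine ⟨⟨Z, z⟩, CategoryOfElements.homMk _ _ t₁ ?_,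
      CategoryOfElements.homMk _ _ t₂ ?_, trivial⟩
    · change L.map (uliftYoneda.map t₁) z = x
      rw [ht₁, L.map_comp, types_comp_apply, hz]
      exact h1
    · change L.map (uliftYoneda.map t₂) z = y
      rw [ht₂, L.map_comp, types_comp_apply, hz]
      exact h2
  cone_maps := by
    rintro ⟨X, x⟩ ⟨Y, y⟩ ⟨f, hf⟩ ⟨g, hg⟩
    let f' := uliftYoneda.{v}.map f
    let g' := uliftYoneda.{v}.map g
    let hl := isLimitForkMapOfIsLimit L _ (equalizerIsEqualizer f' g')
    have hxy : L.map f' x = L.map g' x := hf.trans hg.symm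
    let k : PUnit.{v+1} ⟶ L.obj (uliftYoneda.{v}.obj X) := ↾fun _ ↦ x
    have hk : k ≫ L.map f' = k ≫ L.map g' := by
      ext
      exact hxy
    obtain ⟨l, hl'⟩ := Fork.IsLimit.lift' hl k hk
    obtain ⟨Z, s, z, hz⟩ := exists_map_uliftYoneda_eq L _ (l PUnit.unit)
    have h1 := ConcreteCategory.congr_hom hl' PUnit.unit
    obtain ⟨t, ht⟩ := uliftYoneda.{v}.map_surjective (s ≫ equalizer.ι f' g')
    refine ⟨⟨Z, z⟩, CategoryOfElements.homMk _ _ t ?_, ?_⟩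
    · change L.map (uliftYoneda.map t) z = x
      rw [ht, L.map_comp, types_comp_apply, hz]
      exact h1
    · apply CategoryOfElements.ext
      apply uliftYoneda.{v}.map_injective
      change uliftYoneda.map (t ≫ f) = uliftYoneda.map (t ≫ g)
      rw [Functor.map_comp, Functor.map_comp, ht, Category.assoc, Category.assoc]
      exact congrArg (s ≫ ·) (equalizer.condition f' g')
  nonempty := by
    let hl := isLimitChangeEmptyCone _ (isLimitOfPreserves L
      (terminalIsTerminal (C := Cᵒᵖ ⥤ Type v))) (asEmptyCone _) (Iso.refl _)
    obtain ⟨Z, s, z, -⟩ := exists_map_uliftYoneda_eq L _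
      ((IsTerminal.from hl PUnit.{v+1}) PUnit.unit)
    exact ⟨⟨Z, z⟩⟩

end PresheafTopos

/-! ### Points of a presheaf topos -/

/-- The functors to types whose category of elements is cofiltered. -/
def cofilteredElements (C : Type) [SmallCategory C] : ObjectProperty (C ⥤ Type) :=
  fun F ↦ IsCofiltered F.Elements

namespace GeometricMorphism

variable {C : Type} [SmallCategory C]

instance preservesColimits_inverseImage (f : ToposPoint (Cᵒᵖ ⥤ Type)) :
    PreservesColimitsOfSize.{0, 0} f.inverseImage :=
  f.adj.leftAdjoint_preservesColimits

/-- The functor sending a point of a presheaf topos to the restriction of its inverse image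
functor to representables. -/
def fiberFunctor (C : Type) [SmallCategory C] : ToposPoint (Cᵒᵖ ⥤ Type) ⥤ C ⥤ Type where
  obj f := uliftYoneda.{0} ⋙ f.inverseImage
  map {f g} (a : f.inverseImage ⟶ g.inverseImage) := Functor.whiskerLeft uliftYoneda.{0} a

/-- A morphism of points of a presheaf topos is determined by its values on representables,
which can be prescribed. -/
lemma bijective_fiberFunctor_map (f g : ToposPoint (Cᵒᵖ ⥤ Type)) :
    Function.Bijective ((fiberFunctor C).map : (f ⟶ g) → _) := by
  -- The universal property of the Kan extension is the required bijection.
  have := Presheaf.isLeftKanExtension_of_preservesColimits.{0} f.inverseImage (Iso.refl _)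
  let e := f.inverseImage.homEquivOfIsLeftKanExtension
    (Iso.refl (uliftYoneda.{0} ⋙ f.inverseImage)).hom g.inverseImage
  have he : ((fiberFunctor C).map : (f ⟶ g) → _) = e :=
    funext fun a ↦ (Category.id_comp _).symm
  rw [he]
  exact e.bijective

instance : (fiberFunctor C).Faithful where
  map_injective h := (bijective_fiberFunctor_map _ _).1 h

instance : (fiberFunctor C).Full where
  map_surjective := (bijective_fiberFunctor_map _ _).2

lemma cofilteredElements_fiberFunctor_obj (f : ToposPoint (Cᵒᵖ ⥤ Type)) :
    cofilteredElements C ((fiberFunctor C).obj f) :=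
  have := f.preservesFiniteLimits
  isCofiltered_elements_uliftYoneda_comp f.inverseImage

/-- The point of the presheaf topos with a given fiber functor. -/
noncomputable def ofFiber (F : C ⥤ Type) (hF : cofilteredElements C F) :
    ToposPoint (Cᵒᵖ ⥤ Type) :=
  have : IsCofiltered F.Elements := hF
  let Φ : GrothendieckTopology.Point.{0} (⊥ : GrothendieckTopology C) :=
    { fiber := F
      initiallySmall :=
        have := essentiallySmallSelf.{0} F.Elements
        initiallySmall_of_essentiallySmall _
      jointly_surjective {X} R hR x := by
        -- For the trivial topology only maximal sieves cover, so the identity is a witness.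
        obtain rfl : R = ⊤ := by simpa using hR
        exact ⟨X, 𝟙 _, by simp, x, by simp⟩ }
  { directImage := Φ.skyscraperPresheafFunctor
    inverseImage := Φ.presheafFiber
    adj := Φ.skyscraperPresheafAdjunction
    preservesFiniteLimits := inferInstance }

/-- The fiber functor of `ofFiber F hF` is `F`. -/
noncomputable def fiberFunctorOfFiberIso (F : C ⥤ Type) (hF : cofilteredElements C F) :
    (fiberFunctor C).obj (ofFiber F hF) ≅ F :=
  have : IsCofiltered F.Elements := hF
  Functor.isoWhiskerRight (uliftYonedaIsoYoneda.{0} ≪≫ (shrinkYonedaIsoYoneda.{0}).symm) _ ≪≫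
    GrothendieckTopology.Point.shrinkYonedaCompPresheafFiberIso _

/-- The points of a presheaf topos are the functors with cofiltered category of elements. -/
noncomputable def equivCofilteredElements (C : Type) [SmallCategory C] :
    ToposPoint (Cᵒᵖ ⥤ Type) ≌ (cofilteredElements C).FullSubcategory :=
  let G := (cofilteredElements C).lift (fiberFunctor C) cofilteredElements_fiberFunctor_obj
  have : G.EssSurj := ⟨fun F ↦ ⟨ofFiber F.1 F.2,
    ⟨(cofilteredElements C).isoMk (fiberFunctorOfFiberIso F.1 F.2)⟩⟩⟩
  have : G.IsEquivalence := { }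
  G.asEquivalence

end GeometricMorphism

/-! ### Arithmetic of the max-plus rationals -/

namespace QMax

/-- The element of `ℚ_max` given by a rational number. -/
def ofRat (q : ℚ) : QMax := Tropical.trop ((OrderDual.toDual q : ℚᵒᵈ) : WithTop ℚᵒᵈ)

lemma ofRat_injective : Function.Injective ofRat := fun _ _ h ↦
  OrderDual.toDual.injective (WithTop.coe_injective (Tropical.trop_injective h))

lemma ofRat_zero : ofRat 0 = 1 := rfl

lemma ofRat_add (p q : ℚ) : ofRat (p + q) = ofRat p * ofRat q := rfl

lemma ofRat_ne_zero (q : ℚ) : ofRat q ≠ 0 := fun h ↦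
  WithTop.coe_ne_top (Tropical.trop_injective h)

lemma ofRat_nsmul (n : ℕ) (q : ℚ) : ofRat (n * q) = ofRat q ^ n := by
  induction n with
  | zero => simp [ofRat_zero]
  | succ n ih => rw [pow_succ, ← ih, ← ofRat_add]; congr 1; push_cast; ring

lemma ofRat_max (p q : ℚ) : ofRat (max p q) = ofRat p + ofRat q := by
  refine Tropical.untrop_injective ?_
  rw [Tropical.untrop_add]
  exact WithTop.coe_min (OrderDual.toDual p) (OrderDual.toDual q)

lemma eq_zero_or_exists_ofRat (x : QMax) : x = 0 ∨ ∃ q, x = ofRat q := by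
  induction x using Tropical.tropRec with | _ x
  induction x using WithTop.recTopCoe with
  | top => exact Or.inl rfl
  | coe a => exact Or.inr ⟨OrderDual.ofDual a, rfl⟩

/-- Expresses positivity in semiring terms, so that injective morphisms preserve it. Injectivity is
needed for `x ≠ 1`: sending every nonzero element to `1` is also a morphism. -/
lemma add_one_eq_self_and_ne_one_iff (x : QMax) :
    x + 1 = x ∧ x ≠ 1 ↔ ∃ q, 0 < q ∧ x = ofRat q := by
  obtain rfl | ⟨q, rfl⟩ := eq_zero_or_exists_ofRat x
  · simp only [zero_add, one_ne_zero, false_and, false_iff, not_exists, not_and]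
    exact fun q _ h ↦ ofRat_ne_zero q h.symm
  · rw [← ofRat_zero, ← ofRat_max, ofRat_injective.eq_iff, ofRat_injective.ne_iff, max_eq_left_iff]
    constructor
    · exact fun h ↦ ⟨q, lt_of_le_of_ne h.1 h.2.symm, rfl⟩
    · rintro ⟨p, hp, h⟩
      rw [ofRat_injective h]
      exact ⟨hp.le, hp.ne'⟩

lemma zmaxToQMax_trop (n : ℤ) :
    zmaxToQMax (Tropical.trop ((OrderDual.toDual n : ℤᵒᵈ) : WithTop ℤᵒᵈ)) = ofRat n := rfl

/-- Multiplication by a positive rational number, as an endomorphism of `ℚ_max`. -/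
def scale (r : ℚ) (hr : 0 < r) : QMax →+* QMax where
  toFun x := Tropical.trop ((Tropical.untrop x).map
    (fun q ↦ OrderDual.toDual (r * OrderDual.ofDual q)))
  map_zero' := rfl
  map_one' := congrArg ofRat (mul_zero r)
  map_mul' x y := by
    obtain rfl | ⟨p, rfl⟩ := eq_zero_or_exists_ofRat x
    · rfl
    obtain rfl | ⟨q, rfl⟩ := eq_zero_or_exists_ofRat y
    · rfl
    exact congrArg ofRat (mul_add r p q)
  map_add' x y := by
    have hm : Monotone (WithTop.map
        (fun q : ℚᵒᵈ ↦ OrderDual.toDual (r * OrderDual.ofDual q))) :=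
      Monotone.withTop_map fun a b h ↦
        OrderDual.toDual_le_toDual.2
          (mul_le_mul_of_nonneg_left (OrderDual.ofDual_le_ofDual.2 h) hr.le)
    exact congrArg Tropical.trop (hm.map_min (a := Tropical.untrop x) (b := Tropical.untrop y))

lemma scale_ofRat (r : ℚ) (hr : 0 < r) (q : ℚ) : scale r hr (ofRat q) = ofRat (r * q) := rfl

lemma scale_injective (r : ℚ) (hr : 0 < r) : Function.Injective (scale r hr) := by
  intro x y h
  obtain rfl | ⟨p, rfl⟩ := eq_zero_or_exists_ofRat x
  · obtain rfl | ⟨q, rfl⟩ := eq_zero_or_exists_ofRat y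
    · rfl
    · rw [map_zero, scale_ofRat] at h
      exact absurd h.symm (ofRat_ne_zero _)
  · obtain rfl | ⟨q, rfl⟩ := eq_zero_or_exists_ofRat y
    · rw [map_zero, scale_ofRat] at h
      exact absurd h (ofRat_ne_zero _)
    · rw [scale_ofRat, scale_ofRat] at h
      rw [mul_left_cancel₀ hr.ne' (ofRat_injective h)]

end QMax

/-- Two positive rational numbers are positive multiples of a common element of the subgroup which
they generate. -/
lemma AddSubgroup.exists_common_divisor (H : AddSubgroup ℚ) {p q : ℚ} (hp : 0 < p) (hq : 0 < q)
    (hpH : p ∈ H) (hqH : q ∈ H) :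
    ∃ r ∈ H, 0 < r ∧ ∃ m n : ℕ+, p = m * r ∧ q = n * r := by
  let a : ℤ := p.num * q.den
  let b : ℤ := q.num * p.den
  let d : ℚ := p.den * q.den
  have hpd : (0 : ℚ) < p.den := by exact_mod_cast p.pos
  have hqd : (0 : ℚ) < q.den := by exact_mod_cast q.pos
  have hd : 0 < d := mul_pos hpd hqd
  have ha : 0 < a := mul_pos (Rat.num_pos.2 hp) (by exact_mod_cast q.pos)
  have hb : 0 < b := mul_pos (Rat.num_pos.2 hq) (by exact_mod_cast p.pos)
  have hpa : p * d = a := by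
    simp only [a, d]; push_cast
    rw [← mul_assoc, Rat.mul_den_eq_num]
  have hqb : q * d = b := by
    simp only [b, d]; push_cast
    rw [mul_comm (p.den : ℚ), ← mul_assoc, Rat.mul_den_eq_num]
  have hg : 0 < Int.gcd a b := Int.gcd_pos_of_ne_zero_left _ ha.ne'
  have hgq : (0 : ℚ) < Int.gcd a b := by exact_mod_cast hg
  have hbez : ((Int.gcd a b : ℕ) : ℚ) = a * Int.gcdA a b + b * Int.gcdB a b := by
    exact_mod_cast Int.gcd_eq_gcd_ab a b
  obtain ⟨m, hm⟩ := Int.gcd_dvd_left a b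
  obtain ⟨n, hn⟩ := Int.gcd_dvd_right a b
  have hgz : (0 : ℤ) < Int.gcd a b := by exact_mod_cast hg
  have hm0 : 0 < m := pos_of_mul_pos_right (hm ▸ ha) hgz.le
  have hn0 : 0 < n := pos_of_mul_pos_right (hn ▸ hb) hgz.le
  lift m to ℕ using hm0.le
  lift n to ℕ using hn0.le
  have hmq : (a : ℚ) = Int.gcd a b * m := by exact_mod_cast hm
  have hnq : (b : ℚ) = Int.gcd a b * n := by exact_mod_cast hn
  -- Over the common denominator `d` the numerators are `a` and `b`; Bézout puts `gcd(a, b) / d` in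
  -- the subgroup.
  refine ⟨Int.gcd a b / d, ?_, div_pos hgq hd, ⟨m, by exact_mod_cast hm0⟩,
    ⟨n, by exact_mod_cast hn0⟩, ?_, ?_⟩
  · have : (Int.gcd a b : ℚ) / d = Int.gcdA a b • p + Int.gcdB a b • q := by
      rw [div_eq_iff hd.ne', hbez, ← hpa, ← hqb, zsmul_eq_mul, zsmul_eq_mul]
      ring
    rw [this]
    exact H.add_mem (H.zsmul_mem hpH _) (H.zsmul_mem hqH _)
  · rw [PNat.mk_coe, ← mul_div_assoc, eq_div_iff hd.ne', hpa, hmq, mul_comm]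
  · rw [PNat.mk_coe, ← mul_div_assoc, eq_div_iff hd.ne', hqb, hnq, mul_comm]

/-! ### Intermediate semifields and their positive parts -/

namespace IntermediateSemifield

open QMax

/-- The group of rational numbers in an intermediate semifield. -/
def ratSubgroup (K : IntermediateSemifield) : AddSubgroup ℚ where
  carrier := {q | ofRat q ∈ K.toSubsemiring}
  zero_mem' := K.one_mem
  add_mem' hp hq := K.mul_mem hp hq
  neg_mem' hq := K.inv_mem' _ hq

lemma one_mem_ratSubgroup (K : IntermediateSemifield) : 1 ∈ K.ratSubgroup := by
  have := K.zmax_mem' (Tropical.trop ((OrderDual.toDual 1 : ℤᵒᵈ) : WithTop ℤᵒᵈ))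
  rw [zmaxToQMax_trop, Int.cast_one] at this
  exact this

/-- The intermediate semifield of a group of rational numbers containing the integers. -/
def ofAddSubgroup (H : AddSubgroup ℚ) (h1 : 1 ∈ H) : IntermediateSemifield where
  carrier := {x | x = 0 ∨ ∃ q ∈ H, x = ofRat q}
  zero_mem' := Or.inl rfl
  one_mem' := Or.inr ⟨0, H.zero_mem, rfl⟩
  mul_mem' := by
    rintro x y (rfl | ⟨p, hp, rfl⟩) (rfl | ⟨q, hq, rfl⟩)
    · exact Or.inl (zero_mul _)
    · exact Or.inl (zero_mul _)
    · exact Or.inl (mul_zero _)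
    · exact Or.inr ⟨_, H.add_mem hp hq, rfl⟩
  add_mem' := by
    rintro x y (rfl | ⟨p, hp, rfl⟩) (rfl | ⟨q, hq, rfl⟩)
    · exact Or.inl (zero_add _)
    · exact Or.inr ⟨q, hq, zero_add _⟩
    · exact Or.inr ⟨p, hp, add_zero _⟩
    · refine Or.inr ⟨max p q, ?_, (ofRat_max p q).symm⟩
      obtain h | h := max_choice p q <;> rwa [h]
  inv_mem' := by
    rintro x (rfl | ⟨p, hp, rfl⟩)
    · exact Or.inl inv_zero
    · exact Or.inr ⟨_, H.neg_mem hp, rfl⟩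
  zmax_mem' x := by
    induction x using Tropical.tropRec with | _ x
    induction x using WithTop.recTopCoe with
    | top => exact Or.inl rfl
    | coe a =>
      refine Or.inr ⟨((OrderDual.ofDual a : ℤ) : ℚ), ?_, rfl⟩
      have := H.zsmul_mem h1 (OrderDual.ofDual a)
      rwa [zsmul_one] at this

lemma mem_ratSubgroup_ofAddSubgroup {H : AddSubgroup ℚ} (h1 : 1 ∈ H) {q : ℚ} :
    q ∈ (ofAddSubgroup H h1).ratSubgroup ↔ q ∈ H := by
  constructor
  · rintro (h | ⟨p, hp, h⟩)
    · exact absurd h (ofRat_ne_zero q)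
    · rwa [ofRat_injective h]
  · exact fun h ↦ Or.inr ⟨q, h, rfl⟩

/-- The elements of an intermediate semifield given by positive rational numbers. -/
def Pos (K : IntermediateSemifield) : Type :=
  {x : K.Carrier // ∃ q, 0 < q ∧ (x : QMax) = ofRat q}

namespace Pos

variable {K L : IntermediateSemifield}

/-- The element given by a positive rational number. -/
def mk (q : ℚ) (hq : 0 < q) (hK : q ∈ K.ratSubgroup) : Pos K := ⟨⟨ofRat q, hK⟩, q, hq, rfl⟩

lemma ext {x y : Pos K} (h : (x.1 : QMax) = y.1) : x = y := Subtype.ext (Subtype.ext h)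

lemma exists_eq_mk (x : Pos K) : ∃ q hq hK, x = mk q hq hK := by
  obtain ⟨⟨x, hx⟩, q, hq, rfl : x = _⟩ := x
  exact ⟨q, hq, hx, rfl⟩

lemma mk_inj {p q : ℚ} {hp hpK hq hqK} : (mk p hp hpK : Pos K) = mk q hq hqK ↔ p = q := by
  constructor
  · exact fun h ↦ ofRat_injective (congrArg (fun x : Pos K ↦ (x.1 : QMax)) h)
  · rintro rfl
    rfl

/-- The action of positive integers by powers. -/
def pow (n : ℕ+) (x : Pos K) : Pos K := ⟨x.1 ^ (n : ℕ), by
  obtain ⟨x, q, hq, h⟩ := x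
  refine ⟨n * q, by positivity, ?_⟩
  rw [ofRat_nsmul]
  exact congrArg (· ^ (n : ℕ)) h⟩

lemma pow_mk (n : ℕ+) (q : ℚ) (hq : 0 < q) (hK : q ∈ K.ratSubgroup) :
    pow n (mk q hq hK) = mk (n * q) (by positivity)
      (by simpa using K.ratSubgroup.nsmul_mem hK n) :=
  ext (ofRat_nsmul n q).symm

/-- The map induced by an injective morphism of semifields. -/
def map (f : K ⟶ L) (x : Pos K) : Pos L := ⟨f.1 x.1, by
  obtain ⟨x, hx⟩ := x
  rw [← add_one_eq_self_and_ne_one_iff] at hx ⊢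
  constructor
  · have h : x + 1 = x := Subtype.ext hx.1
    have := congrArg f.1 h
    rw [map_add, map_one] at this
    exact congrArg Subtype.val this
  · intro h
    have : f.1 x = f.1 1 := (Subtype.ext h : f.1 x = 1).trans (map_one f.1).symm
    exact hx.2 (congrArg Subtype.val (f.2 this))⟩

end Pos

/-- The functor sending an intermediate semifield to the set of its positive rational elements,
with the action of `ℕ+`. -/
def posFunctor : IntermediateSemifield ⥤ SingleObj ℕ+ ⥤ Type where
  obj K :=
    { obj := fun _ ↦ Pos K
      map := fun n ↦ ↾Pos.pow n
      map_id := fun _ ↦ by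
        ext x
        exact Subtype.ext (pow_one _)
      map_comp := fun m n ↦ by
        ext x
        exact Subtype.ext ((congrArg (x.1 ^ ·) (mul_comm (n : ℕ) m)).trans (pow_mul _ _ _)) }
  map f :=
    { app := fun _ ↦ ↾Pos.map f
      naturality := fun _ _ n ↦ by
        ext x
        exact Subtype.ext (map_pow f.1 x.1 n) }

lemma cofilteredElements_posFunctor_obj (K : IntermediateSemifield) :
    cofilteredElements (SingleObj ℕ+) (posFunctor.obj K) where
  cone_objs := by
    rintro ⟨_, x : Pos K⟩ ⟨_, y : Pos K⟩
    obtain ⟨p, hp, hpK, rfl⟩ := x.exists_eq_mk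
    obtain ⟨q, hq, hqK, rfl⟩ := y.exists_eq_mk
    obtain ⟨r, hrK, hr, m, n, rfl, rfl⟩ := K.ratSubgroup.exists_common_divisor hp hq hpK hqK
    exact ⟨⟨SingleObj.star ℕ+, (Pos.mk r hr hrK : Pos K)⟩,
      CategoryOfElements.homMk _ _ m (Pos.pow_mk m r hr hrK),
      CategoryOfElements.homMk _ _ n (Pos.pow_mk n r hr hrK), trivial⟩
  cone_maps := by
    rintro ⟨_, x : Pos K⟩ Y ⟨m : ℕ+, hm⟩ ⟨n : ℕ+, hn⟩
    -- Parallel arrows are equal, since `m * p = n * p` with `p > 0`; the identity equalizes them.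
    refine ⟨_, 𝟙 _, ?_⟩
    congr 1
    apply CategoryOfElements.ext
    have h : x.pow m = x.pow n := hm.trans hn.symm
    obtain ⟨p, hp, hpK, rfl⟩ := x.exists_eq_mk
    rw [Pos.pow_mk, Pos.pow_mk, Pos.mk_inj] at h
    have := mul_right_cancel₀ hp.ne' h
    change m = n
    exact_mod_cast this
  nonempty := ⟨⟨SingleObj.star ℕ+, (Pos.mk 1 one_pos K.one_mem_ratSubgroup : Pos K)⟩⟩

instance : posFunctor.Faithful where
  map_injective {K L f g} h := by
    have hpos (x : Pos K) : f.1 x.1 = g.1 x.1 := by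
      have h' : Pos.map f x = Pos.map g x := ConcreteCategory.congr_hom
        (NatTrans.congr_app h (SingleObj.star ℕ+)) x
      exact congrArg Subtype.val h'
    refine Subtype.ext (RingHom.ext fun x ↦ ?_)
    obtain ⟨x, hx⟩ := x
    obtain rfl | ⟨q, rfl⟩ := eq_zero_or_exists_ofRat x
    · exact (map_zero f.1).trans (map_zero g.1).symm
    obtain hq | rfl | hq := lt_trichotomy 0 q
    · exact hpos (Pos.mk q hq hx)
    · exact (map_one f.1).trans (map_one g.1).symm
    · have := hpos (Pos.mk (-q) (neg_pos.2 hq) (K.ratSubgroup.neg_mem hx))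
      let x : K.Carrier := ⟨ofRat q, hx⟩
      change f.1 x⁻¹ = g.1 x⁻¹ at this
      rw [map_inv₀, map_inv₀] at this
      exact inv_injective this

/-- An equivariant map of positive rational elements is a multiplication by a positive rational
number. -/
lemma Pos.exists_eq_mul {K L : IntermediateSemifield} (φ : Pos K → Pos L)
    (hφ : ∀ (n : ℕ+) x, φ (x.pow n) = (φ x).pow n) :
    ∃ r, 0 < r ∧ ∀ q hq hK, ∃ h h', φ (mk q hq hK) = mk (r * q) h h' := by
  obtain ⟨r, hr, hrL, h1⟩ := (φ (mk 1 one_pos K.one_mem_ratSubgroup)).exists_eq_mk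
  refine ⟨r, hr, fun q hq hK ↦ ?_⟩
  obtain ⟨s, hs, hsL, h2⟩ := (φ (mk q hq hK)).exists_eq_mk
  -- With `q = a / b`, equivariance gives `b * s = a * r`, which determines `s`.
  let b : ℕ+ := ⟨q.den, q.pos⟩
  let a : ℕ+ := ⟨q.num.toNat, by simpa using hq⟩
  have hab : (b : ℚ) * q = a * 1 := by
    have : ((q.num.toNat : ℕ) : ℚ) = q.num := by
      exact_mod_cast Int.toNat_of_nonneg (Rat.num_nonneg.2 hq.le)
    simp only [a, b, PNat.mk_coe, mul_one, this]
    rw [mul_comm, Rat.mul_den_eq_num]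
  have h : (mk q hq hK).pow b = (mk 1 one_pos K.one_mem_ratSubgroup).pow a := by
    rw [pow_mk, pow_mk, mk_inj, hab]
  have h' := congrArg φ h
  rw [hφ, hφ, h1, h2, pow_mk, pow_mk, mk_inj] at h'
  have hb : (b : ℚ) ≠ 0 := by positivity
  have : s = r * q := by
    apply mul_left_cancel₀ hb
    rw [h', mul_left_comm, hab]
    ring
  subst this
  exact ⟨hs, hsL, h2⟩

instance : posFunctor.Full where
  map_surjective {K L} φ := by
    obtain ⟨r, hr, h⟩ := Pos.exists_eq_mul (K := K) (L := L) (φ.app (SingleObj.star ℕ+))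
      (fun n x ↦ NatTrans.naturality_apply φ (X := SingleObj.star ℕ+) (Y := SingleObj.star ℕ+) n x)
    have hmem (x : K.Carrier) : scale r hr x ∈ L.toSubsemiring := by
      obtain ⟨x, hx⟩ := x
      obtain rfl | ⟨q, rfl⟩ := eq_zero_or_exists_ofRat x
      · exact L.zero_mem
      change r * q ∈ L.ratSubgroup
      obtain hq | rfl | hq := lt_trichotomy 0 q
      · exact (h q hq hx).2.1
      · rw [mul_zero]
        exact L.ratSubgroup.zero_mem
      · rw [← neg_mem_iff, ← mul_neg]
        exact (h (-q) (neg_pos.2 hq) (K.ratSubgroup.neg_mem hx)).2.1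
    refine ⟨⟨((scale r hr).comp K.toSubsemiring.subtype).codRestrict L.toSubsemiring hmem,
      fun x y hxy ↦ Subtype.ext (scale_injective r hr (congrArg Subtype.val hxy))⟩, ?_⟩
    ext _ (x : Pos K)
    obtain ⟨q, hq, hK, rfl⟩ := x.exists_eq_mk
    obtain ⟨_, _, h'⟩ := h q hq hK
    exact (Pos.ext rfl).trans h'.symm

end IntermediateSemifield

/-! ### Flat actions as positive parts of rational groups -/

/-- A free action of the positive integers such that any two elements are multiples of a common
one. -/
structure IsFlatAction (X : Type) [MulAction ℕ+ X] : Prop where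
  eq_of_smul_eq : ∀ (m n : ℕ+) (x : X), m • x = n • x → m = n
  exists_smul_eq : ∀ x y : X, ∃ (z : X) (m n : ℕ+), m • z = x ∧ n • z = y

namespace IsFlatAction

variable {X : Type} [MulAction ℕ+ X]

/-- Makes `ratio` independent of choices: over a common divisor `w` of `z` and `z'`, freeness allows
coefficients to be compared. -/
lemma div_eq_div (hX : IsFlatAction X) {x₀ z z' x : X} {m n m' n' : ℕ+}
    (hm : m • z = x₀) (hn : n • z = x) (hm' : m' • z' = x₀) (hn' : n' • z' = x) :
    (n / m : ℚ) = n' / m' := by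
  obtain ⟨w, a, b, rfl, rfl⟩ := hX.exists_smul_eq z z'
  rw [smul_smul] at hm hn hm' hn'
  have h1 := hX.eq_of_smul_eq _ _ _ (hm.trans hm'.symm)
  have h2 := hX.eq_of_smul_eq _ _ _ (hn.trans hn'.symm)
  have h1' : (m * a : ℚ) = m' * b := by exact_mod_cast congrArg PNat.val h1
  have h2' : (n * a : ℚ) = n' * b := by exact_mod_cast congrArg PNat.val h2
  have ha : (a : ℚ) ≠ 0 := by positivity
  have hb : (b : ℚ) ≠ 0 := by positivity
  rw [← mul_div_mul_right _ _ ha, h1', h2', mul_div_mul_right _ _ hb]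

/-- The group of rational numbers `q` such that `q • x₀` makes sense. -/
def multiplierSubgroup (hX : IsFlatAction X) (x₀ : X) : AddSubgroup ℚ where
  carrier := {q | ∃ (z : X) (m : ℕ+) (k : ℤ), m • z = x₀ ∧ q * m = k}
  zero_mem' := ⟨x₀, 1, 0, one_smul _ _, by simp⟩
  neg_mem' := by
    rintro q ⟨z, m, k, hm, hk⟩
    exact ⟨z, m, -k, hm, by rw [neg_mul, hk, Int.cast_neg]⟩
  add_mem' := by
    rintro p q ⟨z, m, k, hm, hk⟩ ⟨z', m', k', hm', hk'⟩
    -- Passing to `w` gives both fractions the denominator `m * a = m' * b`.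
    obtain ⟨w, a, b, rfl, rfl⟩ := hX.exists_smul_eq z z'
    rw [smul_smul] at hm hm'
    have h : (m * a : ℚ) = m' * b := by
      exact_mod_cast congrArg PNat.val (hX.eq_of_smul_eq _ _ _ (hm.trans hm'.symm))
    refine ⟨w, m * a, k * a + k' * b, hm, ?_⟩
    push_cast
    rw [add_mul, ← hk, ← hk', ← mul_assoc, h]
    ring_nf

lemma one_mem_multiplierSubgroup (hX : IsFlatAction X) (x₀ : X) :
    1 ∈ hX.multiplierSubgroup x₀ :=
  ⟨x₀, 1, 1, one_smul _ _, by simp⟩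

/-- The rational number `q` such that `x = q • x₀`. -/
noncomputable def ratio (hX : IsFlatAction X) (x₀ x : X) : ℚ :=
  (hX.exists_smul_eq x₀ x).choose_spec.choose_spec.choose /
    (hX.exists_smul_eq x₀ x).choose_spec.choose

lemma ratio_eq (hX : IsFlatAction X) {x₀ z x : X} {m n : ℕ+} (hm : m • z = x₀)
    (hn : n • z = x) : hX.ratio x₀ x = n / m :=
  have h := (hX.exists_smul_eq x₀ x).choose_spec.choose_spec.choose_spec
  hX.div_eq_div h.1 h.2 hm hn

lemma ratio_pos (hX : IsFlatAction X) (x₀ x : X) : 0 < hX.ratio x₀ x := by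
  obtain ⟨z, m, n, hm, hn⟩ := hX.exists_smul_eq x₀ x
  rw [hX.ratio_eq hm hn]
  positivity

lemma ratio_mem (hX : IsFlatAction X) (x₀ x : X) :
    hX.ratio x₀ x ∈ hX.multiplierSubgroup x₀ := by
  obtain ⟨z, m, n, hm, hn⟩ := hX.exists_smul_eq x₀ x
  refine ⟨z, m, n, hm, ?_⟩
  rw [hX.ratio_eq hm hn, div_mul_cancel₀ _ (by positivity)]
  rfl

lemma ratio_smul (hX : IsFlatAction X) (x₀ x : X) (k : ℕ+) :
    hX.ratio x₀ (k • x) = k * hX.ratio x₀ x := by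
  obtain ⟨z, m, n, hm, hn⟩ := hX.exists_smul_eq x₀ x
  have hk : (k * n) • z = k • x := by rw [mul_smul, hn]
  rw [hX.ratio_eq hm hn, hX.ratio_eq hm hk, PNat.mul_coe, Nat.cast_mul, mul_div_assoc]

lemma ratio_injective (hX : IsFlatAction X) (x₀ : X) : Function.Injective (hX.ratio x₀) := by
  intro x y h
  obtain ⟨z, a, b, rfl, rfl⟩ := hX.exists_smul_eq x y
  rw [ratio_smul, ratio_smul] at h
  have h' := mul_right_cancel₀ (hX.ratio_pos x₀ z).ne' h
  rw [show a = b by exact_mod_cast h']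

lemma exists_ratio_eq (hX : IsFlatAction X) (x₀ : X) {q : ℚ} (hq : 0 < q)
    (hqX : q ∈ hX.multiplierSubgroup x₀) : ∃ x, hX.ratio x₀ x = q := by
  obtain ⟨z, m, k, hm, hk⟩ := hqX
  have hm0 : (0 : ℚ) < m := by positivity
  have hk0 : 0 < k := by
    have := mul_pos hq hm0
    rw [hk] at this
    exact_mod_cast this
  lift k to ℕ using hk0.le
  let n : ℕ+ := ⟨k, by exact_mod_cast hk0⟩
  refine ⟨n • z, ?_⟩
  rw [hX.ratio_eq hm rfl, PNat.mk_coe, div_eq_iff hm0.ne', hk, Int.cast_natCast]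

/-- A nonempty flat action is that of the positive rational elements of an intermediate
semifield. -/
lemma exists_equiv_pos (hX : IsFlatAction X) (x₀ : X) :
    ∃ (K : IntermediateSemifield) (e : X ≃ K.Pos), ∀ (n : ℕ+) x, e (n • x) = (e x).pow n := by
  let K := IntermediateSemifield.ofAddSubgroup _ (hX.one_mem_multiplierSubgroup x₀)
  have hK {q : ℚ} : q ∈ K.ratSubgroup ↔ q ∈ hX.multiplierSubgroup x₀ :=
    IntermediateSemifield.mem_ratSubgroup_ofAddSubgroup _
  let e (x : X) : K.Pos := IntermediateSemifield.Pos.mk (hX.ratio x₀ x) (hX.ratio_pos x₀ x)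
    (hK.2 (hX.ratio_mem x₀ x))
  refine ⟨K, Equiv.ofBijective e ⟨fun x y h ↦ ?_, fun y ↦ ?_⟩, fun n x ↦ ?_⟩
  · exact hX.ratio_injective x₀ (IntermediateSemifield.Pos.mk_inj.1 h)
  · obtain ⟨q, hq, hqK, rfl⟩ := y.exists_eq_mk
    obtain ⟨x, hx⟩ := hX.exists_ratio_eq x₀ hq (hK.1 hqK)
    exact ⟨x, IntermediateSemifield.Pos.mk_inj.2 hx⟩
  · exact (IntermediateSemifield.Pos.mk_inj (hp := hX.ratio_pos x₀ (n • x)).2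
      (hX.ratio_smul x₀ x n)).trans
      (IntermediateSemifield.Pos.pow_mk n _ (hX.ratio_pos x₀ x) _).symm

end IsFlatAction

/-! ### Essential surjectivity and the equivalence -/

/-- The action of a commutative monoid on the value of a functor at the unique object. -/
abbrev SingleObj.mulActionObj {M : Type} [CommMonoid M] (F : SingleObj M ⥤ Type) :
    MulAction M (F.obj (SingleObj.star M)) where
  smul m x := F.map (X := SingleObj.star M) (Y := SingleObj.star M) m x
  one_smul x := ConcreteCategory.congr_hom (F.map_id (SingleObj.star M)) x
  mul_smul m n x := ConcreteCategory.congr_hom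
    (F.map_comp (X := SingleObj.star M) (Y := SingleObj.star M) (Z := SingleObj.star M) n m) x

/-- An arrow equalizing `m` and `n` can be cancelled in `ℕ+`, which gives freeness; cones over pairs
of objects give common divisors. -/
lemma isFlatAction_of_cofilteredElements (F : SingleObj ℕ+ ⥤ Type)
    (hF : cofilteredElements (SingleObj ℕ+) F) :
    letI := SingleObj.mulActionObj F
    IsFlatAction (F.obj (SingleObj.star ℕ+)) :=
  letI := SingleObj.mulActionObj F
  have : IsCofiltered F.Elements := hF
  { eq_of_smul_eq := fun m n x h ↦ by
      let a : F.Elements := ⟨SingleObj.star ℕ+, x⟩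
      let b : F.Elements := ⟨SingleObj.star ℕ+, m • x⟩
      let f : a ⟶ b := CategoryOfElements.homMk _ _ m rfl
      let g : a ⟶ b := CategoryOfElements.homMk _ _ n h.symm
      exact mul_right_cancel (congrArg Subtype.val (IsCofiltered.eq_condition f g))
    exists_smul_eq := fun x y ↦ by
      let a : F.Elements := ⟨SingleObj.star ℕ+, x⟩
      let b : F.Elements := ⟨SingleObj.star ℕ+, y⟩
      exact ⟨(IsCofiltered.min a b).2, (IsCofiltered.minToLeft a b).1,
        (IsCofiltered.minToRight a b).1, (IsCofiltered.minToLeft a b).2,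
        (IsCofiltered.minToRight a b).2⟩ }

lemma exists_posFunctor_obj_iso (F : SingleObj ℕ+ ⥤ Type)
    (hF : cofilteredElements (SingleObj ℕ+) F) :
    ∃ K, Nonempty (IntermediateSemifield.posFunctor.obj K ≅ F) := by
  let := SingleObj.mulActionObj F
  have : IsCofiltered F.Elements := hF
  obtain ⟨K, e, he⟩ := (isFlatAction_of_cofilteredElements F hF).exists_equiv_pos
    (IsCofiltered.nonempty (C := F.Elements)).some.2
  refine ⟨K, ⟨(NatIso.ofComponents (fun _ ↦ e.toIso) ?_).symm⟩⟩
  intro _ _ n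
  ext x
  exact he n x

/-- The category of points of the topos of `ℕ+`-sets is equivalent to the category of
intermediate semifields `ℤ_max ⊂ K ⊂ ℚ_max`. -/
theorem corollary1 : Nonempty (ToposPoint NTimesTopos ≌ IntermediateSemifield) := by
  let G := (cofilteredElements (SingleObj ℕ+)).lift IntermediateSemifield.posFunctor
    IntermediateSemifield.cofilteredElements_posFunctor_obj
  have : G.EssSurj := ⟨fun F ↦ by
    obtain ⟨K, ⟨i⟩⟩ := exists_posFunctor_obj_iso F.1 F.2
    exact ⟨K, ⟨(cofilteredElements (SingleObj ℕ+)).isoMk i⟩⟩⟩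
  have : G.IsEquivalence := { }
  exact ⟨(GeometricMorphism.equivCofilteredElements (SingleObj ℕ+)).trans G.asEquivalence.symm⟩
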